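/- Let $S=\mathbb{C}[x,y,z]$. For integers $1\le i\le j$ put $g_{i,j}(u,v)=(u-iv)(u-(i+1)v)\cdots(u-jv)$. Let $2\le d_1\le d_2$ be integers, let $d=d_1+d_2$, and let $$f(x,y,z)=x\,(y-z)\,g_{1,d_1-1}(x,y)\,g_{2,d_2}(x,z).$$ Then $\mathcal{A}: f=0$ is an arrangement of $d$ distinct lines in $\mathbb{P}^2(\mathbb{C})$, and the following hold. (1) $\mathcal{A}$ is nearly free with exponents $(d_1,d_2)$. (2) $\mathcal{A}$ has at most two points of multiplicity $>3$, where the multiplicity of a point $P\in\mathbb{P}^2(\mathbb{C})$ is the number of lines of $\mathcal{A}$ passing through $P$. Here, for a homogeneous polynomial $f\in S$, let $J_f=(f_x,f_y,f_z)$ be the Jacobian ideal, let $I_f=\{h\in S : (x,y,z)^n h\subseteq J_f \text{ for some } n\ge 0\}$ be its saturation, and let $N(f)=I_f/J_f$, which is a graded module. The curve $f=0$ is called nearly free if $N(f)\neq 0$ and $\dim_{\mathbb{C}}N(f)_k\le 1$ for all $k$. It is nearly free with exponents $(d_1,d_2)$, where $d_1\le d_2$, if moreover the graded $S$-module $AR(f)=\{(a,b,c)\in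 S^3 : af_x+bf_y+cf_z=0\}$ has a minimal system of three homogeneous generators, of degrees $d_1,d_2,d_2$ (the degree of a homogeneous syzygy being the common degree of $a,b,c$). -/

import Mathlib

open MvPolynomial
open scoped LinearAlgebra.Projectivization

noncomputable section

namespace PlaneCurve

/-- The homogeneous coordinate ring `S = ℂ[x, y, z]` of the complex projective plane,
with `x = X 0`, `y = X 1`, `z = X 2`. -/
abbrev S : Type := MvPolynomial (Fin 3) ℂ

/-- `g i j u v = (u - i v) (u - (i+1) v) ⋯ (u - j v)`. -/
def g (i j : ℕ) (u v : S) : S := ∏ k ∈ Finset.Icc i j, (u - C (k : ℂ) * v)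

/-- The Jacobian ideal `J_f`, generated by the partial derivatives of `f`. -/
def jacobianIdeal (f : S) : Ideal S := Ideal.span (Set.range fun i : Fin 3 => pderiv i f)

/-- The irrelevant ideal `(x, y, z)`. -/
def irrelevantIdeal : Ideal S := Ideal.span (Set.range fun i : Fin 3 => (X i : S))

/-- The saturation `I_f` of the Jacobian ideal with respect to `(x, y, z)`: the union of the
increasing chain of ideals `J_f : (x, y, z)ⁿ`. -/
def saturatedJacobianIdeal (f : S) : Ideal S :=
  ⨆ n : ℕ, (jacobianIdeal f).colon ((irrelevantIdeal ^ n : Ideal S) : Set S)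

/-- The degree `k` part of an ideal of `S`, as a complex vector space. -/
def degreePart (I : Ideal S) (k : ℕ) : Submodule ℂ S :=
  I.restrictScalars ℂ ⊓ homogeneousSubmodule (Fin 3) ℂ k

/-- The degree `k` part `N(f)_k = (I_f)_k / (J_f)_k` of the graded module `N(f) = I_f / J_f`
(for `f` homogeneous). -/
abbrev nPart (f : S) (k : ℕ) : Type :=
  degreePart (saturatedJacobianIdeal f) k ⧸
    (degreePart (jacobianIdeal f) k).comap (degreePart (saturatedJacobianIdeal f) k).subtype

/-- The curve `f = 0` is nearly free: `N(f) ≠ 0` and `dim N(f)_k ≤ 1` for all `k`. -/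
def IsNearlyFree (f : S) : Prop :=
  saturatedJacobianIdeal f ≠ jacobianIdeal f ∧ ∀ k : ℕ, Module.rank ℂ (nPart f k) ≤ 1

/-- The module `AR(f)` of Jacobian syzygies: triples `(a, b, c)` with
`a f_x + b f_y + c f_z = 0`. -/
def syzygies (f : S) : Submodule S (Fin 3 → S) :=
  LinearMap.ker (Fintype.linearCombination S fun i : Fin 3 => pderiv i f)

/-- `AR(f)` has a minimal system of homogeneous generators consisting of three syzygies, of
degrees `e 0`, `e 1`, `e 2`. -/
def HasMinimalSyzygyDegrees (f : S) (e : Fin 3 → ℕ) : Prop :=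
  ∃ r : Fin 3 → Fin 3 → S,
    (∀ i j, (r i j).IsHomogeneous (e i)) ∧
    Submodule.span S (Set.range r) = syzygies f ∧
    ∀ i, r i ∉ Submodule.span S (r '' {i}ᶜ)

/-- The curve `f = 0` is nearly free with exponents `(d₁, d₂)`: it is nearly free, `d₁ ≤ d₂`, and
the degrees of a minimal system of homogeneous generators of `AR(f)` are `d₁, d₂, d₂`. -/
def IsNearlyFreeWithExponents (f : S) (d₁ d₂ : ℕ) : Prop :=
  IsNearlyFree f ∧ d₁ ≤ d₂ ∧ HasMinimalSyzygyDegrees f ![d₁, d₂, d₂]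

/-- A linear form defining the line with dual coordinates `L = (a : b : c)`, that is, the line
`a x + b y + c z = 0` (well defined up to a nonzero constant). -/
def linearForm (L : ℙ ℂ (Fin 3 → ℂ)) : S := ∑ i, C (L.rep i) * X i

/-- The set of lines (in dual coordinates) contained in the curve `f = 0`. -/
def lines (f : S) : Set (ℙ ℂ (Fin 3 → ℂ)) := {L | linearForm L ∣ f}

/-- `f = 0` is an arrangement of `d` (distinct) lines: `f` is homogeneous of degree `d` and is
divisible by the equations of exactly `d` lines. -/
def IsLineArrangement (f : S) (d : ℕ) : Prop :=
  f.IsHomogeneous d ∧ (lines f).encard = d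

/-- The multiplicity of the point `P` in the line arrangement `f = 0`: the number of lines of the
arrangement passing through `P`. -/
def multiplicity (f : S) (P : ℙ ℂ (Fin 3 → ℂ)) : ℕ∞ :=
  {L ∈ lines f | Projectivization.orthogonal L P}.encard

end PlaneCurve

end

noncomputable section

namespace PlaneCurve

/-! ### Substitutions and linear forms -/

/-! Write d₁ = a + 1, d₂ = b + 1, l = y - z and f = l D with D = x A B, where A and B are the two
pencils without x = 0. A vector field θ with D ∣ θ(f) has the form e E + p A ∂_y + q B ∂_z, with E
the Euler field (`exists_eq_logField`), and then θ(f) = D (l (deg f · e + p A_y + q B_z) + p A - q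
B). On l = 0 the pencils share a factor: A = (x - y) G and B ≡ G H mod l, with G = ∏_{2 ≤ k ≤ a} (x
- k y) and H = ∏_{a < k ≤ b+1} (x - k y). Hence θ(f) is a multiple of D G exactly when l divides (x
- y) p - H q + c for some c; the quotient r is free and e is then determined. So these fields form a
free module on (p, q, r), acting by θ(f) = -(l r - (x - y) p + H q) D G (`applyField_syzField`,
`exists_eq_syzField`). Everything follows from this. `AR(f)` is the syzygy module of the regular
sequence (l, x - y, H), generated by its three Koszul relations (`span_syzygies`). The quotient
S/(J_f + (D G)) has a free resolution of length two, hence positive depth, so J_f + (D G) contains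
the saturation (`mem_of_forall_X_mul_mem`); D G lies in it (`satGen_mem`). Thus N(f) is a shift of
S/(l, x - y, H) ≅ ℂ[x]/(x^{b+1-a}), which is nonzero with graded pieces of dimension at most one.
For multiplicities, a point other than the two pencil centres lies on at most one line of each
pencil and possibly on y = z. -/

theorem sub_algHom_mem {I : Ideal S} {σ : S →ₐ[ℂ] S} (h : ∀ i, X i - σ (X i) ∈ I) (w : S) :
    w - σ w ∈ I := by
  have : (Ideal.Quotient.mkₐ ℂ I).comp σ = Ideal.Quotient.mkₐ ℂ I := by
    refine MvPolynomial.algHom_ext fun i => ?_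
    exact (Ideal.Quotient.eq.mpr (h i)).symm
  exact Ideal.Quotient.eq.mp (DFunLike.congr_fun this w).symm

theorem not_dvd_of_eval {p q : S} (P : Fin 3 → ℂ) (hp : eval P p = 0) (hq : eval P q ≠ 0) :
    ¬ p ∣ q := by
  rintro ⟨r, rfl⟩
  exact hq (by simp [hp])

/-- The linear form `xᵢ - c xⱼ`. -/
def lin (i j : Fin 3) (c : ℂ) : S := X i - C c * X j

/-- The substitution `xᵢ ↦ c xⱼ`. -/
def subst (i j : Fin 3) (c : ℂ) : S →ₐ[ℂ] S := aeval (Function.update X i (C c * X j))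

theorem subst_lin {i j : Fin 3} (hij : i ≠ j) (c : ℂ) : subst i j c (lin i j c) = 0 := by
  simp [subst, lin, Function.update_of_ne hij.symm, algebraMap_eq]

theorem lin_dvd_iff {i j : Fin 3} (hij : i ≠ j) (c : ℂ) (w : S) :
    lin i j c ∣ w ↔ subst i j c w = 0 := by
  constructor
  · rintro ⟨r, rfl⟩
    rw [map_mul, subst_lin hij, zero_mul]
  · intro h
    have := sub_algHom_mem (I := Ideal.span {lin i j c}) (σ := subst i j c) (fun k => ?_) w
    · rwa [h, sub_zero, Ideal.mem_span_singleton] at this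
    · rw [Ideal.mem_span_singleton]
      by_cases hk : k = i
      · subst hk
        simp [subst, lin]
      · simp [subst, Function.update_of_ne hk]

theorem eval_lin (P : Fin 3 → ℂ) (i j : Fin 3) (c : ℂ) : eval P (lin i j c) = P i - c * P j := by
  simp [lin]

theorem isHomogeneous_lin (i j : Fin 3) (c : ℂ) : (lin i j c).IsHomogeneous 1 :=
  (isHomogeneous_X ℂ i).sub (isHomogeneous_C_mul_X c j)

theorem lin_ne_zero {i j : Fin 3} (hij : i ≠ j) (c : ℂ) : lin i j c ≠ 0 := by
  intro h
  have := eval_lin (Pi.single i 1) i j c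
  simp [h, hij.symm] at this

/-- The form generates the kernel of a substitution with values in the domain `S`. -/
theorem prime_lin {i j : Fin 3} (hij : i ≠ j) (c : ℂ) : Prime (lin i j c) := by
  refine ⟨lin_ne_zero hij c, fun h => ?_, fun p q h => ?_⟩
  · have := (lin_dvd_iff hij c 1).mp h.dvd
    simp at this
  · simpa only [lin_dvd_iff hij, map_mul, mul_eq_zero] using h

theorem pderiv_lin_of_ne {i j t : Fin 3} (hi : i ≠ t) (hj : j ≠ t) (c : ℂ) :
    pderiv t (lin i j c) = 0 := by
  simp [lin, pderiv_X_of_ne hi, pderiv_X_of_ne hj]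

theorem pderiv_lin_right {i t : Fin 3} (hi : i ≠ t) (c : ℂ) :
    pderiv t (lin i t c) = - C c := by
  simp [lin, pderiv_X_of_ne hi]

/-! ### Pencils of lines -/

/-- The product of the linear forms `x - k xₜ` for `k ∈ s`. -/
def pencil (t : Fin 3) (s : Finset ℕ) : S := ∏ k ∈ s, lin 0 t (k : ℂ)

theorem g_eq_pencil (i j : ℕ) (t : Fin 3) : g i j (X 0) (X t) = pencil t (Finset.Icc i j) := rfl

theorem isHomogeneous_pencil (t : Fin 3) (s : Finset ℕ) :
    (pencil t s).IsHomogeneous s.card := by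
  have := IsHomogeneous.prod s (fun k : ℕ => lin 0 t (k : ℂ)) (fun _ => 1)
    fun k _ => isHomogeneous_lin 0 t k
  simpa [pencil] using this

theorem pderiv_pencil_of_ne {t u : Fin 3} (ht : t ≠ u) (hu : 0 ≠ u) (s : Finset ℕ) :
    pderiv u (pencil t s) = 0 := by
  classical
  induction s using Finset.induction_on with
  | empty => simp [pencil]
  | insert k s hk ih =>
    rw [pencil, Finset.prod_insert hk, Derivation.leibniz, pderiv_lin_of_ne hu ht]
    rw [pencil] at ih
    simp [ih]

theorem eval_pencil (P : Fin 3 → ℂ) (t : Fin 3) (s : Finset ℕ) :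
    eval P (pencil t s) = ∏ k ∈ s, (P 0 - k * P t) := by
  simp [pencil, eval_lin]

theorem pencil_ne_zero {t : Fin 3} (ht : t ≠ 0) (s : Finset ℕ) : pencil t s ≠ 0 :=
  Finset.prod_ne_zero_iff.mpr fun _ _ => lin_ne_zero ht.symm _

theorem not_lin_dvd_pencil {t : Fin 3} (ht : t ≠ 0) {k : ℕ} {s : Finset ℕ} (hk : k ∉ s) :
    ¬ lin 0 t (k : ℂ) ∣ pencil t s := by
  refine not_dvd_of_eval (fun i => if i = 0 then (k : ℂ) else 1) (by simp [eval_lin, ht]) ?_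
  rw [eval_pencil, Finset.prod_ne_zero_iff]
  intro j hj
  have : k ≠ j := fun h => hk (h ▸ hj)
  simpa [ht, sub_eq_zero] using this

/-- A vector field `P ∂ₜ` preserving a pencil without the line `x = 0` is divisible by it. -/
theorem pencil_dvd_of_dvd_mul_pderiv {t : Fin 3} (ht : t ≠ 0) {s : Finset ℕ} (hs : 0 ∉ s)
    {P w : S} (hw : ∀ k ∈ s, ¬ lin 0 t (k : ℂ) ∣ w)
    (h : pencil t s ∣ w * (P * pderiv t (pencil t s))) : pencil t s ∣ P := by
  refine Finset.prod_dvd_of_isRelPrime ?_ ?_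
  · intro i hi j hj hij
    refine ((prime_lin ht.symm _).irreducible.isRelPrime_iff_not_dvd).mpr ?_
    have := not_lin_dvd_pencil ht (k := i) (s := {j}) (by simpa using hij)
    simpa [pencil] using this
  · intro k hk
    have hp := prime_lin ht.symm (k : ℂ)
    have hmem : lin 0 t (k : ℂ) ∣ pencil t s := Finset.dvd_prod_of_mem _ hk
    rcases hp.dvd_or_dvd (hmem.trans h) with h1 | h1
    · exact absurd h1 (hw k hk)
    rcases hp.dvd_or_dvd h1 with h1 | h1
    · exact h1
    exfalso
    have hsplit : pencil t s = lin 0 t (k : ℂ) * pencil t (s.erase k) :=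
      (Finset.mul_prod_erase s _ hk).symm
    -- Modulo `x - k xₜ` the derivative reduces to `-k` times the product of the other factors,
    -- which is nonzero because `0 ∉ s` and the factors are distinct.
    rw [hsplit, Derivation.leibniz, pderiv_lin_right ht.symm, smul_eq_mul, smul_eq_mul,
      dvd_add_right (dvd_mul_right _ _)] at h1
    rcases hp.dvd_or_dvd h1 with h1 | h1
    · exact not_lin_dvd_pencil ht (Finset.notMem_erase k s) h1
    · have hk0 : (k : ℂ) ≠ 0 := by
        rintro h0
        exact hs (by rwa [← Nat.cast_eq_zero (R := ℂ) |>.mp h0])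
      refine not_dvd_of_eval (fun i => if i = 0 then (k : ℂ) else 1) ?_ ?_ h1
      · simp [eval_lin, ht]
      · simpa using hk0

/-- The difference of two parallel pencils is `y - z` times a form. -/
theorem exists_pencil_sub_pencil (s : Finset ℕ) (hs : s.Nonempty) :
    ∃ Q : S, Q.IsHomogeneous (s.card - 1) ∧
      pencil 1 s - pencil 2 s = lin 1 2 1 * Q := by
  classical
  induction hs using Finset.Nonempty.cons_induction with
  | singleton k =>
    refine ⟨-C (k : ℂ), (isHomogeneous_C _ _).neg, ?_⟩
    simp only [pencil, lin, Finset.prod_singleton, C_1]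
    ring
  | cons k s hk hs ih =>
    obtain ⟨Q, hQ, e⟩ := ih
    -- From (x - k y) P₁ - (x - k z) P₂ = (x - k y)(P₁ - P₂) - k (y - z) P₂.
    refine ⟨lin 0 1 k * Q - C (k : ℂ) * pencil 2 s, ?_, ?_⟩
    · have h1 : 1 + (s.card - 1) = s.card := by have := hs.card_pos; omega
      have := (isHomogeneous_lin 0 1 (k : ℂ)).mul hQ
      rw [h1] at this
      rw [Finset.card_cons, Nat.add_sub_cancel]
      exact this.sub ((isHomogeneous_pencil 2 s).C_mul (k : ℂ))
    · simp only [pencil, Finset.prod_cons] at e ⊢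
      rw [sub_eq_iff_eq_add] at e
      rw [e]
      simp only [lin, C_1]
      ring

/-! ### The arrangement and its vector fields -/

/-- The pencil `(x - y)(x - 2y) ⋯ (x - ay)`. -/
abbrev pencilA (a : ℕ) : S := pencil 1 (Finset.Icc 1 a)

/-- The pencil `(x - 2z)(x - 3z) ⋯ (x - (b+1)z)`. -/
abbrev pencilB (b : ℕ) : S := pencil 2 (Finset.Icc 2 (b + 1))

/-- The common factor of the two pencils after restriction to `y = z`. -/
abbrev commonFactor (a : ℕ) : S := pencil 1 (Finset.Icc 2 a)

/-- The cofactor of `commonFactor a` in the restriction of `pencilB b` to `y = z`. -/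
abbrev cofactor (a b : ℕ) : S := pencil 1 (Finset.Icc (a + 1) (b + 1))

/-- The arrangement with the line `y = z` deleted. -/
def deletion (a b : ℕ) : S := X 0 * pencilA a * pencilB b

/-- The arrangement. -/
def arrangement (a b : ℕ) : S := lin 1 2 1 * deletion a b

/-- The action of a vector field on `f`. -/
abbrev applyField (f : S) : (Fin 3 → S) →ₗ[S] S :=
  Fintype.linearCombination S fun i : Fin 3 => pderiv i f

theorem applyField_apply (f : S) (θ : Fin 3 → S) :
    applyField f θ = θ 0 * pderiv 0 f + θ 1 * pderiv 1 f + θ 2 * pderiv 2 f := by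
  simp [applyField, Fintype.linearCombination_apply, Fin.sum_univ_three]

theorem pencilA_eq {a : ℕ} (ha : 1 ≤ a) : pencilA a = lin 0 1 1 * commonFactor a := by
  have : Finset.Icc 1 a = insert 1 (Finset.Icc 2 a) := by
    ext k
    simp only [Finset.mem_Icc, Finset.mem_insert]
    omega
  rw [pencilA, this, pencil, Finset.prod_insert (by simp)]
  simp [commonFactor, pencil]

theorem commonFactor_mul_cofactor {a b : ℕ} (ha : 1 ≤ a) (hab : a ≤ b) :
    commonFactor a * cofactor a b = pencil 1 (Finset.Icc 2 (b + 1)) := by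
  have : Finset.Icc 2 (b + 1) = Finset.Icc 2 a ∪ Finset.Icc (a + 1) (b + 1) := by
    ext k
    simp only [Finset.mem_Icc, Finset.mem_union]
    omega
  rw [this, pencil, Finset.prod_union]
  · rfl
  · rw [Finset.disjoint_left]
    intro k
    simp only [Finset.mem_Icc]
    omega

theorem euler_pencil_one (s : Finset ℕ) :
    X 0 * pderiv 0 (pencil 1 s) + X 1 * pderiv 1 (pencil 1 s) = C (s.card : ℂ) * pencil 1 s := by
  have := (isHomogeneous_pencil 1 s).sum_X_mul_pderiv
  rw [Fin.sum_univ_three, pderiv_pencil_of_ne (t := 1) (u := 2) (by decide) (by decide),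
    mul_zero, add_zero, nsmul_eq_mul] at this
  rw [this, map_natCast]

theorem euler_pencil_two (s : Finset ℕ) :
    X 0 * pderiv 0 (pencil 2 s) + X 2 * pderiv 2 (pencil 2 s) = C (s.card : ℂ) * pencil 2 s := by
  have := (isHomogeneous_pencil 2 s).sum_X_mul_pderiv
  rw [Fin.sum_univ_three, pderiv_pencil_of_ne (t := 2) (u := 1) (by decide) (by decide),
    mul_zero, add_zero, nsmul_eq_mul] at this
  rw [this, map_natCast]

theorem applyField_arrangement (a b : ℕ) (θ : Fin 3 → S) :
    applyField (arrangement a b) θ = deletion a b * (θ 1 - θ 2) +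
      lin 1 2 1 * (θ 0 * (pencilA a * pencilB b) +
        X 0 * pencilB b * (θ 0 * pderiv 0 (pencilA a) + θ 1 * pderiv 1 (pencilA a)) +
        X 0 * pencilA a * (θ 0 * pderiv 0 (pencilB b) + θ 2 * pderiv 2 (pencilB b))) := by
  rw [applyField_apply]
  have hl : (lin 1 2 1 : S) = X 1 - X 2 := by simp [lin]
  have e1 : pderiv 2 (pencilA a) = 0 := pderiv_pencil_of_ne (by decide) (by decide) _
  have e2 : pderiv 1 (pencilB b) = 0 := pderiv_pencil_of_ne (by decide) (by decide) _
  simp only [arrangement, deletion, hl, Derivation.leibniz, map_sub, e1, e2, smul_eq_mul,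
    pderiv_X_self, pderiv_X_of_ne (show (1 : Fin 3) ≠ 0 by decide),
    pderiv_X_of_ne (show (2 : Fin 3) ≠ 0 by decide),
    pderiv_X_of_ne (show (0 : Fin 3) ≠ 1 by decide),
    pderiv_X_of_ne (show (2 : Fin 3) ≠ 1 by decide),
    pderiv_X_of_ne (show (0 : Fin 3) ≠ 2 by decide),
    pderiv_X_of_ne (show (1 : Fin 3) ≠ 2 by decide)]
  ring

/-- The vector field `e E + p A ∂_y + q B ∂_z`, where `E` is the Euler field. -/
def logField (a b : ℕ) (e p q : S) : Fin 3 → S :=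
  ![e * X 0, e * X 1 + p * pencilA a, e * X 2 + q * pencilB b]

/-- Euler's formula for f, of degree `a + b + 2`, gives the `e` term. The last two terms come from
the derivatives of `y - z`. -/
theorem applyField_logField (a b : ℕ) (e p q : S) :
    applyField (arrangement a b) (logField a b e p q) = deletion a b *
      (lin 1 2 1 * (C ((a + b + 2 : ℕ) : ℂ) * e + p * pderiv 1 (pencilA a) +
        q * pderiv 2 (pencilB b)) + p * pencilA a - q * pencilB b) := by
  rw [applyField_arrangement]
  have hl : (lin 1 2 1 : S) = X 1 - X 2 := by simp [lin]
  have hA := euler_pencil_one (Finset.Icc 1 a)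
  have hB := euler_pencil_two (Finset.Icc 2 (b + 1))
  have cA : (Finset.Icc 1 a).card = a := by simp
  have cB : (Finset.Icc 2 (b + 1)).card = b := by simp
  rw [cA] at hA
  rw [cB] at hB
  simp only [logField, deletion, hl, Matrix.cons_val_zero, Matrix.cons_val_one, Matrix.cons_val,
    Nat.cast_add, C_add]
  have h2 : (C ((2 : ℕ) : ℂ) : S) = 2 := map_ofNat C 2
  rw [h2]
  linear_combination (X 1 - X 2) * X 0 * e * pencilB b * hA + (X 1 - X 2) * X 0 * e * pencilA a * hB

theorem exists_eq_logField {a b : ℕ} {θ : Fin 3 → S}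
    (h : deletion a b ∣ applyField (arrangement a b) θ) :
    ∃ e p q, θ = logField a b e p q := by
  have hl : (lin 1 2 1 : S) = X 1 - X 2 := by simp [lin]
  have hX : (X 0 : S) = lin 0 1 0 := by simp [lin]
  have hX0 : Prime (X 0 : S) := hX ▸ prime_lin (by decide) 0
  rw [applyField_arrangement, dvd_add_right (dvd_mul_right _ _)] at h
  have h0 : (X 0 : S) ∣ θ 0 := by
    have h1 : (X 0 : S) ∣ deletion a b := ⟨pencilA a * pencilB b, by rw [deletion]; ring⟩
    rcases hX0.dvd_or_dvd (h1.trans h) with h2 | h2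
    · exact absurd h2 (not_dvd_of_eval ![0, 1, 0] (by simp) (by simp [eval_lin]))
    -- Modulo `x` only `θ 0 * A * B` survives, and neither pencil vanishes at (0 : 1 : 1).
    · rw [add_assoc, mul_assoc, mul_assoc, ← mul_add, dvd_add_left (dvd_mul_right _ _)] at h2
      rcases hX0.dvd_or_dvd h2 with h3 | h3
      · exact h3
      · refine absurd h3 (not_dvd_of_eval ![0, 1, 1] (by simp) ?_)
        rw [map_mul, eval_pencil, eval_pencil]
        refine mul_ne_zero (Finset.prod_ne_zero_iff.mpr ?_) (Finset.prod_ne_zero_iff.mpr ?_) <;>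
        · intro k hk
          rw [Finset.mem_Icc] at hk
          simpa using (show k ≠ 0 by omega)
  obtain ⟨e, he⟩ := h0
  have hA := euler_pencil_one (Finset.Icc 1 a)
  have hB := euler_pencil_two (Finset.Icc 2 (b + 1))
  -- Subtracting `e` times the Euler field changes the expression by a multiple of the deletion,
  -- which removes `θ 0`.
  have key : deletion a b ∣ lin 1 2 1 * (X 0 * pencilB b * ((θ 1 - e * X 1) * pderiv 1 (pencilA a)) +
      X 0 * pencilA a * ((θ 2 - e * X 2) * pderiv 2 (pencilB b))) := by
    refine (dvd_add_right (a := deletion a b) (b := deletion a b * (lin 1 2 1 * e * (1 +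
      C ((Finset.Icc 1 a).card : ℂ) + C ((Finset.Icc 2 (b + 1)).card : ℂ))))
      (dvd_mul_right _ _)).mp ?_
    convert h using 1
    rw [he, deletion]
    linear_combination (- lin 1 2 1 * X 0 * e * pencilB b) * hA -
      lin 1 2 1 * X 0 * e * pencilA a * hB
  have dA : pencilA a ∣ θ 1 - e * X 1 := by
    refine pencil_dvd_of_dvd_mul_pderiv (by decide) (by simp)
      (w := lin 1 2 1 * (X 0 * pencilB b)) ?_ ?_
    · intro k hk
      have hk0 : k ≠ 0 := by
        rw [Finset.mem_Icc] at hk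
        omega
      -- At z = 0 the other pencil becomes a power of x, so it cannot vanish where x = k ≠ 0.
      refine not_dvd_of_eval ![k, 1, 0] (by simp [eval_lin]) ?_
      rw [map_mul, map_mul, eval_pencil, eval_lin]
      simp [hk0]
    · have h1 : pencilA a ∣ deletion a b := ⟨X 0 * pencilB b, by rw [deletion]; ring⟩
      have h2 := h1.trans key
      rw [mul_add, dvd_add_left ⟨lin 1 2 1 * X 0 * ((θ 2 - e * X 2) * pderiv 2 (pencilB b)),
        by ring⟩] at h2
      convert h2 using 1
      ring
  have dB : pencilB b ∣ θ 2 - e * X 2 := by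
    refine pencil_dvd_of_dvd_mul_pderiv (by decide) (by simp)
      (w := lin 1 2 1 * (X 0 * pencilA a)) ?_ ?_
    · intro k hk
      have hk0 : k ≠ 0 := by
        rw [Finset.mem_Icc] at hk
        omega
      refine not_dvd_of_eval ![k, 0, 1] (by simp [eval_lin]) ?_
      rw [map_mul, map_mul, eval_pencil, eval_lin]
      simp [hk0]
    · have h1 : pencilB b ∣ deletion a b := ⟨X 0 * pencilA a, by rw [deletion]; ring⟩
      have h2 := h1.trans key
      rw [mul_add, dvd_add_right ⟨lin 1 2 1 * X 0 * ((θ 1 - e * X 1) * pderiv 1 (pencilA a)),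
        by ring⟩] at h2
      convert h2 using 1
      ring
  obtain ⟨p, hp⟩ := dA
  obtain ⟨q, hq⟩ := dB
  refine ⟨e, p, q, ?_⟩
  ext1 i
  fin_cases i
  · simp [logField, he, mul_comm]
  · simp only [logField, Fin.mk_one, Matrix.cons_val_one, Matrix.cons_val_zero]
    linear_combination hp
  · simp only [logField, Fin.reduceFinMk, Matrix.cons_val]
    linear_combination hq

/-! ### The kernel of the action on the arrangement -/

/-- The Euler coefficient making the field with coordinates `w` act as a multiple of
`deletion a b * commonFactor a`. -/
def eulerCoeff (a b : ℕ) (Q : S) (w : Fin 3 → S) : S :=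
  C (-((a + b + 2 : ℕ) : ℂ)⁻¹) * (w 0 * pderiv 1 (pencilA a) + w 1 * pderiv 2 (pencilB b) +
    w 1 * Q + w 2 * commonFactor a)

/-- The vector fields mapping the arrangement into the ideal generated by
`deletion a b * commonFactor a`. -/
def syzField (a b : ℕ) (Q : S) : (Fin 3 → S) →ₗ[S] (Fin 3 → S) where
  toFun w := logField a b (eulerCoeff a b Q w) (w 0) (w 1)
  map_add' v w := by
    ext1 i
    fin_cases i <;> simp [logField, eulerCoeff] <;> ring
  map_smul' c w := by
    ext1 i
    fin_cases i <;> simp [logField, eulerCoeff] <;> ring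

/-- The relation satisfied by the coordinates of a syzygy. -/
def relForm (a b : ℕ) : (Fin 3 → S) →ₗ[S] S where
  toFun w := lin 1 2 1 * w 2 - lin 0 1 1 * w 0 + cofactor a b * w 1
  map_add' v w := by
    simp only [Pi.add_apply]
    ring
  map_smul' c w := by
    simp only [Pi.smul_apply, smul_eq_mul, RingHom.id_apply]
    ring

theorem relForm_apply (a b : ℕ) (w : Fin 3 → S) :
    relForm a b w = lin 1 2 1 * w 2 - lin 0 1 1 * w 0 + cofactor a b * w 1 := rfl

theorem deletion_ne_zero (a b : ℕ) : deletion a b ≠ 0 :=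
  mul_ne_zero (mul_ne_zero (X_ne_zero 0) (pencil_ne_zero (by decide) _))
    (pencil_ne_zero (by decide) _)

theorem C_mul_C_neg_inv (d : ℕ) (p : S) :
    C ((d + 2 : ℕ) : ℂ) * (C (-((d + 2 : ℕ) : ℂ)⁻¹) * p) = -p := by
  have : ((d + 2 : ℕ) : ℂ) ≠ 0 := Nat.cast_ne_zero.mpr (by omega)
  rw [← mul_assoc, ← C_mul, mul_neg, mul_inv_cancel₀ this, C_neg, C_1, neg_one_mul]

section

variable {a b : ℕ} {Q : S}

theorem applyField_syzField (ha : 1 ≤ a) (hab : a ≤ b)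
    (hQ : pencil 1 (Finset.Icc 2 (b + 1)) - pencilB b = lin 1 2 1 * Q) (w : Fin 3 → S) :
    applyField (arrangement a b) (syzField a b Q w) =
      -(relForm a b w * (deletion a b * commonFactor a)) := by
  change applyField _ (logField a b _ _ _) = _
  have h1 := pencilA_eq ha
  have h2 := commonFactor_mul_cofactor ha hab
  rw [applyField_logField, eulerCoeff, C_mul_C_neg_inv, relForm_apply]
  linear_combination deletion a b * w 0 * h1 + deletion a b * w 1 * hQ +
    deletion a b * w 1 * h2

theorem syzField_injective : Function.Injective (syzField a b Q) := by
  rw [injective_iff_map_eq_zero]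
  intro w hw
  have e0 : eulerCoeff a b Q w * X 0 = 0 := congr_fun hw 0
  have e1 : eulerCoeff a b Q w * X 1 + w 0 * pencilA a = 0 := congr_fun hw 1
  have e2 : eulerCoeff a b Q w * X 2 + w 1 * pencilB b = 0 := congr_fun hw 2
  have h0 : eulerCoeff a b Q w = 0 := (mul_eq_zero.mp e0).resolve_right (X_ne_zero 0)
  rw [h0, zero_mul, zero_add] at e1 e2
  have h1 : w 0 = 0 := (mul_eq_zero.mp e1).resolve_right (pencil_ne_zero (by decide) _)
  have h2 : w 1 = 0 := (mul_eq_zero.mp e2).resolve_right (pencil_ne_zero (by decide) _)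
  have h3 := C_mul_C_neg_inv (a + b) (w 0 * pderiv 1 (pencilA a) + w 1 * pderiv 2 (pencilB b) +
    w 1 * Q + w 2 * commonFactor a)
  rw [← eulerCoeff, h0, h1, h2, mul_zero, eq_comm, neg_eq_zero] at h3
  have h4 : w 2 * commonFactor a = 0 := by linear_combination h3
  have h5 : w 2 = 0 := (mul_eq_zero.mp h4).resolve_right (pencil_ne_zero (by decide) _)
  ext1 i
  fin_cases i <;> assumption

/-- After cancelling the deletion, `commonFactor a` times a form is divisible by `y - z`. Since
`commonFactor a` is prime to `y - z`, the form itself is divisible; the quotient is the third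
coordinate, and the Euler coefficient is then forced. -/
theorem exists_eq_syzField (ha : 1 ≤ a) (hab : a ≤ b)
    (hQ : pencil 1 (Finset.Icc 2 (b + 1)) - pencilB b = lin 1 2 1 * Q) {θ : Fin 3 → S} {c : S}
    (h : applyField (arrangement a b) θ + c * (deletion a b * commonFactor a) = 0) :
    ∃ w, θ = syzField a b Q w ∧ c = relForm a b w := by
  have h1 := pencilA_eq ha
  have h2 := commonFactor_mul_cofactor ha hab
  obtain ⟨e, p, q, rfl⟩ := exists_eq_logField (a := a) (b := b) (θ := θ)
    ⟨-(c * commonFactor a), by linear_combination h⟩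
  rw [applyField_logField] at h
  have h3 : lin 1 2 1 * (C ((a + b + 2 : ℕ) : ℂ) * e + p * pderiv 1 (pencilA a) +
      q * pderiv 2 (pencilB b) + q * Q) +
      commonFactor a * (p * lin 0 1 1 - q * cofactor a b + c) = 0 := by
    refine (mul_eq_zero.mp (?_ : deletion a b * _ = 0)).resolve_left (deletion_ne_zero a b)
    linear_combination h - deletion a b * p * h1 - deletion a b * q * hQ - deletion a b * q * h2
  have h4 : lin 1 2 1 ∣ p * lin 0 1 1 - q * cofactor a b + c := by
    have h5 : lin 1 2 1 ∣ commonFactor a * (p * lin 0 1 1 - q * cofactor a b + c) :=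
      (dvd_add_right (dvd_mul_right _ _)).mp (h3 ▸ dvd_zero _)
    refine ((prime_lin (by decide) 1).dvd_or_dvd h5).resolve_left ?_
    refine not_dvd_of_eval ![1, 0, 0] (by simp [eval_lin]) ?_
    simp [eval_pencil]
  obtain ⟨r, hr⟩ := h4
  rw [hr] at h3
  have h6 : C ((a + b + 2 : ℕ) : ℂ) * e + p * pderiv 1 (pencilA a) +
      q * pderiv 2 (pencilB b) + q * Q + r * commonFactor a = 0 := by
    refine (mul_eq_zero.mp (?_ : lin 1 2 1 * _ = 0)).resolve_left (lin_ne_zero (by decide) 1)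
    linear_combination h3
  refine ⟨![p, q, r], ?_, ?_⟩
  · change _ = logField a b _ _ _
    have : e = eulerCoeff a b Q ![p, q, r] := by
      have h7 : C ((a + b + 2 : ℕ) : ℂ) * (e - eulerCoeff a b Q ![p, q, r]) = 0 := by
        rw [mul_sub, eulerCoeff, C_mul_C_neg_inv]
        simp only [Matrix.cons_val_zero, Matrix.cons_val_one, Matrix.cons_val]
        linear_combination h6
      have h8 : (C ((a + b + 2 : ℕ) : ℂ) : S) ≠ 0 := by
        rw [Ne, C_eq_zero, Nat.cast_eq_zero]
        omega
      exact sub_eq_zero.mp ((mul_eq_zero.mp h7).resolve_left h8)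
    rw [← this]
    rfl
  · rw [relForm_apply]
    simp only [Matrix.cons_val_zero, Matrix.cons_val_one, Matrix.cons_val]
    linear_combination hr

/-! ### Syzygies -/

/-- The coordinates of the three generating syzygies. -/
def syzCoords (a b : ℕ) : Fin 3 → Fin 3 → S :=
  ![![lin 1 2 1, 0, lin 0 1 1], ![cofactor a b, lin 0 1 1, 0], ![0, lin 1 2 1, -cofactor a b]]

/-- The substitution `x, y, z ↦ x`. -/
def diag : S →ₐ[ℂ] S := aeval fun _ => X 0

theorem sub_diag_mem (w : S) : w - diag w ∈ Ideal.span {lin 0 1 1, lin 1 2 1} := by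
  refine sub_algHom_mem (fun i => ?_) w
  rw [Ideal.mem_span_pair]
  fin_cases i
  · exact ⟨0, 0, by simp [diag]⟩
  · exact ⟨-1, 0, by simp [diag, lin]⟩
  · exact ⟨-1, -1, by simp [diag, lin]⟩

theorem diag_lin : diag (lin 0 1 1) = 0 ∧ diag (lin 1 2 1) = 0 := by
  simp [diag, lin]

theorem diag_cofactor (a b : ℕ) : diag (cofactor a b) =
    C (∏ k ∈ Finset.Icc (a + 1) (b + 1), (1 - (k : ℂ))) * X 0 ^ (Finset.Icc (a + 1) (b + 1)).card := by
  rw [cofactor, pencil, map_prod, map_prod, ← Finset.prod_const, ← Finset.prod_mul_distrib]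
  refine Finset.prod_congr rfl fun k _ => ?_
  simp only [diag, lin, map_sub, map_mul, aeval_X, aeval_C, algebraMap_eq, C_1]
  ring

theorem diag_cofactor_const_ne_zero (ha : 1 ≤ a) (b : ℕ) :
    ∏ k ∈ Finset.Icc (a + 1) (b + 1), (1 - (k : ℂ)) ≠ 0 := by
  rw [Finset.prod_ne_zero_iff]
  intro k hk
  rw [Finset.mem_Icc] at hk
  rw [sub_ne_zero]
  exact_mod_cast (show 1 ≠ k by omega)

/-- Koszul exactness for the regular sequence y - z, x - y, H. Modulo the two linear forms H is a
nonzero constant times a power of x, so `w 1` lies in their ideal; subtracting the matching Koszul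
relations leaves a relation between two coprime linear forms. -/
theorem mem_span_syzCoords (ha : 1 ≤ a) {w : Fin 3 → S} (hw : relForm a b w = 0) :
    w ∈ Submodule.span S (Set.range (syzCoords a b)) := by
  rw [relForm_apply] at hw
  have h1 : diag (w 1) = 0 := by
    have := congr_arg diag hw
    simp only [map_sub, map_add, map_mul, diag_lin, zero_mul, sub_self, zero_add, map_zero,
      diag_cofactor] at this
    refine (mul_eq_zero.mp this).resolve_left (mul_ne_zero ?_ (pow_ne_zero _ (X_ne_zero 0)))
    rw [Ne, C_eq_zero]
    exact diag_cofactor_const_ne_zero ha b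
  have h2 := sub_diag_mem (w 1)
  rw [h1, sub_zero, Ideal.mem_span_pair] at h2
  obtain ⟨s, t, hst⟩ := h2
  have h3 : lin 1 2 1 ∣ lin 0 1 1 * (w 0 - s * cofactor a b) :=
    ⟨w 2 + t * cofactor a b, by linear_combination -hw - cofactor a b * hst⟩
  have h4 : lin 1 2 1 ∣ w 0 - s * cofactor a b := by
    refine ((prime_lin (by decide) 1).dvd_or_dvd h3).resolve_left ?_
    exact not_dvd_of_eval ![1, 0, 0] (by simp [eval_lin]) (by simp [eval_lin])
  obtain ⟨u, hu⟩ := h4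
  have h5 : w 2 = u * lin 0 1 1 - t * cofactor a b := by
    refine mul_left_cancel₀ (lin_ne_zero (i := 1) (j := 2) (by decide) 1) ?_
    linear_combination hw + cofactor a b * hst + lin 0 1 1 * hu
  rw [Submodule.mem_span_range_iff_exists_fun]
  refine ⟨![u, s, t], ?_⟩
  ext1 i
  fin_cases i
  · simp [Fin.sum_univ_three, syzCoords]
    linear_combination -hu
  · simp [Fin.sum_univ_three, syzCoords, hst]
  · simp [Fin.sum_univ_three, syzCoords, h5]
    ring

theorem relForm_syzCoords (i : Fin 3) : relForm a b (syzCoords a b i) = 0 := by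
  fin_cases i <;> simp [syzCoords, relForm_apply] <;> ring

theorem span_syzygies (ha : 1 ≤ a) (hab : a ≤ b)
    (hQ : pencil 1 (Finset.Icc 2 (b + 1)) - pencilB b = lin 1 2 1 * Q) :
    Submodule.span S (Set.range fun i => syzField a b Q (syzCoords a b i)) =
      syzygies (arrangement a b) := by
  apply le_antisymm
  · rw [Submodule.span_le]
    rintro _ ⟨i, rfl⟩
    change applyField _ _ = 0
    simp only [applyField_syzField ha hab hQ, relForm_syzCoords, zero_mul, neg_zero]
  · intro θ hθ
    have h : applyField (arrangement a b) θ = 0 := hθ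
    obtain ⟨w, rfl, hw⟩ := exists_eq_syzField ha hab hQ (θ := θ) (c := 0) (by rw [h]; ring)
    have := Submodule.mem_map_of_mem (f := syzField a b Q) (mem_span_syzCoords ha hw.symm)
    rwa [Submodule.map_span, ← Set.range_comp] at this

theorem eval_cofactor_eq_zero (hab : a ≤ b) {P : Fin 3 → ℂ} (hP : P 0 = (b + 1) * P 1) :
    eval P (cofactor a b) = 0 := by
  rw [eval_pencil, Finset.prod_eq_zero_iff]
  exact ⟨b + 1, by simp [hab], by simp [hP]⟩

/-- For each generator there is a point where one of its coordinates is nonzero while the same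
coordinate of the other two vanishes. For the first, the point lies on x = (b + 1) y, a factor of
the cofactor. -/
theorem syzCoords_notMem (hab : a ≤ b) (i : Fin 3) :
    syzCoords a b i ∉ Submodule.span S (syzCoords a b '' {i}ᶜ) := by
  fin_cases i
  · have : ({(0 : Fin 3)}ᶜ : Set (Fin 3)) = {1, 2} := by ext i; fin_cases i <;> simp
    simp only [Fin.zero_eta, this, Set.image_pair, Submodule.mem_span_pair]
    rintro ⟨u, v, h⟩
    have h0 := congr_arg (eval ![(b : ℂ) + 1, 1, 0]) (congr_fun h 0)
    have hH := eval_cofactor_eq_zero hab (P := ![(b : ℂ) + 1, 1, 0]) (by simp)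
    simp [syzCoords, eval_lin, hH] at h0
  · have : ({(1 : Fin 3)}ᶜ : Set (Fin 3)) = {0, 2} := by ext i; fin_cases i <;> simp
    simp only [Fin.mk_one, this, Set.image_pair, Submodule.mem_span_pair]
    rintro ⟨u, v, h⟩
    have h0 := congr_arg (eval ![1, 0, 0]) (congr_fun h 1)
    simp [syzCoords, eval_lin] at h0
  · have : ({(2 : Fin 3)}ᶜ : Set (Fin 3)) = {0, 1} := by ext i; fin_cases i <;> simp
    simp only [Fin.reduceFinMk, this, Set.image_pair, Submodule.mem_span_pair]
    rintro ⟨u, v, h⟩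
    have h0 := congr_arg (eval ![1, 1, 0]) (congr_fun h 1)
    simp [syzCoords, eval_lin] at h0

theorem isHomogeneous_logField {e p q : S} {n : ℕ} (he : e.IsHomogeneous n)
    (hp : (p * pencilA a).IsHomogeneous (n + 1)) (hq : (q * pencilB b).IsHomogeneous (n + 1))
    (i : Fin 3) : (logField a b e p q i).IsHomogeneous (n + 1) := by
  fin_cases i
  · exact he.mul (isHomogeneous_X ℂ 0)
  · exact (he.mul (isHomogeneous_X ℂ 1)).add hp
  · exact (he.mul (isHomogeneous_X ℂ 2)).add hq

theorem isHomogeneous_syzField (ha : 1 ≤ a) (hab : a ≤ b) (hQh : Q.IsHomogeneous (b - 1))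
    (i j : Fin 3) : (syzField a b Q (syzCoords a b i) j).IsHomogeneous
      ((![a + 1, b + 1, b + 1] : Fin 3 → ℕ) i) := by
  have hA : (pencilA a).IsHomogeneous a := by simpa using isHomogeneous_pencil 1 (Finset.Icc 1 a)
  have hB : (pencilB b).IsHomogeneous b := by
    simpa using isHomogeneous_pencil 2 (Finset.Icc 2 (b + 1))
  have hG : (commonFactor a).IsHomogeneous (a - 1) := by
    have := isHomogeneous_pencil 1 (Finset.Icc 2 a)
    rwa [Nat.card_Icc, Nat.add_sub_add_right a 1 1] at this
  have hH : (cofactor a b).IsHomogeneous (b + 1 - a) := by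
    have := isHomogeneous_pencil 1 (Finset.Icc (a + 1) (b + 1))
    rwa [Nat.card_Icc, Nat.add_sub_add_right] at this
  have hA' := hA.pderiv (i := 1)
  have hB' := hB.pderiv (i := 2)
  have h1 := isHomogeneous_lin 0 1 1
  have hl := isHomogeneous_lin 1 2 1
  have z (n : ℕ) : (0 : S).IsHomogeneous n := isHomogeneous_zero _ _ n
  have cast {p : S} {m n : ℕ} (h : p.IsHomogeneous m) (e : m = n) : p.IsHomogeneous n := e ▸ h
  fin_cases i
  · refine isHomogeneous_logField (n := a) ?_ (cast (hl.mul hA) (by omega)) ?_ j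
    · refine IsHomogeneous.C_mul (((IsHomogeneous.add (cast (hl.mul hA') (by omega)) ?_).add ?_).add
        (cast (h1.mul hG) (by omega))) _
      · simpa [syzCoords] using z a
      · simpa [syzCoords] using z a
    · simpa [syzCoords] using z (a + 1)
  · refine isHomogeneous_logField (n := b) ?_ (cast (hH.mul hA) (by omega))
      (cast (h1.mul hB) (by omega)) j
    refine IsHomogeneous.C_mul (((IsHomogeneous.add (cast (hH.mul hA') (by omega))
      (cast (h1.mul hB') (by omega))).add (cast (h1.mul hQh) (by omega))).add ?_) _
    simpa [syzCoords] using z b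
  · refine isHomogeneous_logField (n := b) ?_ ?_ (cast (hl.mul hB) (by omega)) j
    · refine IsHomogeneous.C_mul (((IsHomogeneous.add ?_ (cast (hl.mul hB') (by omega))).add
        (cast (hl.mul hQh) (by omega))).add (cast (hH.neg.mul hG) (by omega))) _
      simpa [syzCoords] using z b
    · simpa [syzCoords] using z (b + 1)

theorem hasMinimalSyzygyDegrees_arrangement (ha : 1 ≤ a) (hab : a ≤ b) :
    HasMinimalSyzygyDegrees (arrangement a b) ![a + 1, b + 1, b + 1] := by
  obtain ⟨Q, hQh, hQ⟩ := exists_pencil_sub_pencil (Finset.Icc 2 (b + 1)) ⟨2, by simp; omega⟩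
  have hc : (Finset.Icc 2 (b + 1)).card = b := by simp
  rw [hc] at hQh
  refine ⟨fun i => syzField a b Q (syzCoords a b i), isHomogeneous_syzField ha hab hQh,
    span_syzygies ha hab hQ, fun i hi => syzCoords_notMem hab i ?_⟩
  have e : (fun i => syzField a b Q (syzCoords a b i)) '' {i}ᶜ =
      syzField a b Q '' (syzCoords a b '' {i}ᶜ) := by rw [← Set.image_comp]; rfl
  rw [e, ← Submodule.map_span, Submodule.mem_map] at hi
  obtain ⟨w, hw, h⟩ := hi
  rwa [syzField_injective h] at hw

end

/-! ### The saturation of the Jacobian ideal -/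

theorem mem_jacobianIdeal_iff {f h : S} :
    h ∈ jacobianIdeal f ↔ ∃ θ : Fin 3 → S, applyField f θ = h := by
  rw [jacobianIdeal, Ideal.span, Submodule.mem_span_range_iff_exists_fun]
  rfl

/-- The form generating the saturation of the Jacobian ideal modulo the Jacobian ideal. -/
def satGen (a b : ℕ) : S := deletion a b * commonFactor a

theorem mem_jacobianIdeal_sup_iff {f h₀ h : S} :
    h ∈ jacobianIdeal f ⊔ Ideal.span {h₀} ↔
      ∃ (θ : Fin 3 → S) (c : S), applyField f θ + c * h₀ = h := by
  rw [Submodule.mem_sup]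
  constructor
  · rintro ⟨p, hp, q, hq, rfl⟩
    obtain ⟨θ, rfl⟩ := mem_jacobianIdeal_iff.mp hp
    obtain ⟨c, rfl⟩ := Ideal.mem_span_singleton'.mp hq
    exact ⟨θ, c, rfl⟩
  · rintro ⟨θ, c, rfl⟩
    exact ⟨_, mem_jacobianIdeal_iff.mpr ⟨θ, rfl⟩, _, Ideal.mem_span_singleton'.mpr ⟨c, rfl⟩, rfl⟩

/-- z is a nonzerodivisor modulo (x, y). -/
theorem exists_of_X_two_mul {u v w : S} (h : X 2 * u + X 0 * v + X 1 * w = 0) :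
    ∃ r s : S, u = r * X 0 + s * X 1 := by
  let σ : S →ₐ[ℂ] S := aeval ![0, 0, X 2]
  have h1 : σ u = 0 := by
    have := congr_arg σ h
    have h0 : σ (X 0) = 0 := by simp [σ]
    have h1 : σ (X 1) = 0 := by simp [σ]
    have h2 : σ (X 2) = X 2 := by simp [σ]
    rw [map_add, map_add, map_mul, map_mul, map_mul, h0, h1, h2, zero_mul, zero_mul, add_zero,
      add_zero, map_zero] at this
    exact (mul_eq_zero.mp this).resolve_left (X_ne_zero 2)
  have h2 := sub_algHom_mem (I := Ideal.span {X 0, X 1}) (σ := σ) (fun i => ?_) u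
  · rw [h1, sub_zero, Ideal.mem_span_pair] at h2
    obtain ⟨r, s, h2⟩ := h2
    exact ⟨r, s, h2.symm⟩
  · rw [Ideal.mem_span_pair]
    fin_cases i
    · exact ⟨1, 0, by simp [σ]⟩
    · exact ⟨0, 1, by simp [σ]⟩
    · exact ⟨0, 0, by simp [σ]⟩

theorem X_zero_dvd_of_mul_eq {p q : S} (h : X 1 * p = X 0 * q) : (X 0 : S) ∣ p := by
  have hX : (X 0 : S) = lin 0 1 0 := by simp [lin]
  have hX0 : Prime (X 0 : S) := hX ▸ prime_lin (by decide) 0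
  exact (hX0.dvd_or_dvd ⟨q, h⟩).resolve_left (not_dvd_of_eval ![0, 1, 0] (by simp) (by simp))

section

variable {a b : ℕ}

/-- The quotient of `S` by the Jacobian ideal and `satGen a b` has positive depth. -/
theorem mem_of_forall_X_mul_mem (ha : 1 ≤ a) (hab : a ≤ b) {h : S}
    (hX : ∀ i, X i * h ∈ jacobianIdeal (arrangement a b) ⊔ Ideal.span {satGen a b}) :
    h ∈ jacobianIdeal (arrangement a b) ⊔ Ideal.span {satGen a b} := by
  obtain ⟨Q, -, hQ⟩ := exists_pencil_sub_pencil (Finset.Icc 2 (b + 1)) ⟨2, by simp; omega⟩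
  simp only [mem_jacobianIdeal_sup_iff] at hX ⊢
  choose θ c hθ using hX
  -- Both `X j * (X i * h)` and `X i * (X j * h)` are the same element, so the difference of their
  -- two expressions is a relation among the generators and comes from the free module of
  -- coordinates.
  have hker (i j : Fin 3) : ∃ w, (X j : S) • θ i - (X i : S) • θ j = syzField a b Q w ∧
      X j * c i - X i * c j = relForm a b w := by
    refine exists_eq_syzField ha hab hQ ?_
    rw [map_sub, map_smul, map_smul, smul_eq_mul, smul_eq_mul]
    have hi := hθ i
    have hj := hθ j
    rw [satGen] at hi hj
    linear_combination X j * hi - X i * hj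
  obtain ⟨u, hu, hu'⟩ := hker 0 1
  obtain ⟨v, hv, -⟩ := hker 1 2
  obtain ⟨w, hw, -⟩ := hker 2 0
  -- Cocycle identity, valid for the coordinates because `syzField` is injective. It puts `u` in (x,
  -- y) times the free module, which allows `θ 0` and `c 0` to be corrected by a relation into
  -- multiples of x.
  have h0 : (X 2 : S) • u + (X 0 : S) • v + (X 1 : S) • w = 0 := by
    apply syzField_injective (a := a) (b := b) (Q := Q)
    simp only [map_add, map_smul, ← hu, ← hv, ← hw, map_zero]
    module
  have hdec (i : Fin 3) : ∃ r s : S, u i = r * X 0 + s * X 1 :=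
    exists_of_X_two_mul (congr_fun h0 i)
  choose r s hrs using hdec
  have hu2 : u = (X 0 : S) • r + (X 1 : S) • s := by
    ext1 i
    simp [hrs i, mul_comm]
  have hdvd (i : Fin 3) : (X 0 : S) ∣ θ 0 i - syzField a b Q s i := by
    refine X_zero_dvd_of_mul_eq (q := θ 1 i + syzField a b Q r i) ?_
    have := congr_fun hu i
    rw [hu2, map_add, map_smul, map_smul] at this
    simp only [Pi.sub_apply, Pi.add_apply, Pi.smul_apply, smul_eq_mul] at this
    linear_combination this
  obtain ⟨γ, hγ⟩ : (X 0 : S) ∣ c 0 - relForm a b s := by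
    refine X_zero_dvd_of_mul_eq (q := c 1 + relForm a b r) ?_
    rw [hu2, map_add, map_smul, map_smul, smul_eq_mul, smul_eq_mul] at hu'
    linear_combination hu'
  choose η hη using hdvd
  have hθ0 : θ 0 = (X 0 : S) • η + syzField a b Q s := by
    ext1 i
    simp only [Pi.add_apply, Pi.smul_apply, smul_eq_mul]
    linear_combination hη i
  refine ⟨η, γ, mul_left_cancel₀ (X_ne_zero (0 : Fin 3)) ?_⟩
  rw [← hθ 0, hθ0, map_add, map_smul, applyField_syzField ha hab hQ, smul_eq_mul, satGen]
  linear_combination -deletion a b * commonFactor a * hγ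

theorem saturatedJacobianIdeal_le (ha : 1 ≤ a) (hab : a ≤ b) :
    saturatedJacobianIdeal (arrangement a b) ≤
      jacobianIdeal (arrangement a b) ⊔ Ideal.span {satGen a b} := by
  refine iSup_le fun n => ?_
  induction n with
  | zero =>
    intro h hh
    rw [Submodule.mem_colon] at hh
    have := hh 1 (by simp)
    exact Submodule.mem_sup_left (by simpa using this)
  | succ n ih =>
    intro h hh
    rw [Submodule.mem_colon] at hh
    refine mem_of_forall_X_mul_mem ha hab fun i => ih ?_
    rw [Submodule.mem_colon]
    intro p hp
    have hX : (X i : S) ∈ irrelevantIdeal := Ideal.subset_span ⟨i, rfl⟩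
    have := hh (p * X i) (by rw [pow_succ]; exact Ideal.mul_mem_mul hp hX)
    simpa [mul_comm, mul_left_comm] using this

theorem mul_satGen_mem (ha : 1 ≤ a) (hab : a ≤ b) (w : Fin 3 → S) :
    relForm a b w * satGen a b ∈ jacobianIdeal (arrangement a b) := by
  obtain ⟨Q, -, hQ⟩ := exists_pencil_sub_pencil (Finset.Icc 2 (b + 1)) ⟨2, by simp; omega⟩
  rw [← neg_mem_iff]
  exact mem_jacobianIdeal_iff.mpr ⟨_, applyField_syzField ha hab hQ w⟩

theorem lin_mul_satGen_mem (ha : 1 ≤ a) (hab : a ≤ b) {p : S}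
    (hp : p ∈ Ideal.span {lin 0 1 1, lin 1 2 1}) :
    p * satGen a b ∈ jacobianIdeal (arrangement a b) := by
  obtain ⟨r, s, rfl⟩ := Ideal.mem_span_pair.mp hp
  convert mul_satGen_mem ha hab ![-r, 0, s] using 2
  simp [relForm_apply]
  ring

/-- The colon ideal contains x - y, y - z and H, hence a power of x, hence a power of the irrelevant
ideal. -/
theorem satGen_mem (ha : 1 ≤ a) (hab : a ≤ b) :
    satGen a b ∈ saturatedJacobianIdeal (arrangement a b) := by
  set K : Ideal S := (jacobianIdeal (arrangement a b)).colon {satGen a b} with hK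
  have mem_K (p : S) : p ∈ K ↔ p * satGen a b ∈ jacobianIdeal (arrangement a b) := by
    rw [hK, Submodule.mem_colon_singleton, smul_eq_mul]
  have hlin : Ideal.span {lin 0 1 1, lin 1 2 1} ≤ K :=
    fun p hp => (mem_K p).mpr (lin_mul_satGen_mem ha hab hp)
  have hcof : cofactor a b ∈ K := by
    rw [mem_K]
    simpa [relForm_apply] using mul_satGen_mem ha hab ![0, 1, 0]
  have hX0 : (X 0 : S) ∈ K.radical := by
    refine ⟨(Finset.Icc (a + 1) (b + 1)).card, ?_⟩
    have h1 := K.sub_mem hcof (hlin (sub_diag_mem (cofactor a b)))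
    rw [sub_sub_cancel, diag_cofactor] at h1
    have h2 := K.mul_mem_left
      (C (∏ k ∈ Finset.Icc (a + 1) (b + 1), (1 - (k : ℂ)))⁻¹) h1
    rwa [← mul_assoc, ← C_mul, inv_mul_cancel₀ (diag_cofactor_const_ne_zero ha b), C_1,
      one_mul] at h2
  have hle : irrelevantIdeal ≤ K.radical := by
    refine Ideal.span_le.mpr ?_
    rintro _ ⟨i, rfl⟩
    have := K.radical.add_mem (Ideal.le_radical (hlin (sub_diag_mem (X i)))) hX0
    simpa [diag] using this
  obtain ⟨n, hn⟩ := Ideal.exists_pow_le_of_le_radical_of_fg hle (IsNoetherian.noetherian _)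
  refine (le_iSup (fun n : ℕ => (jacobianIdeal (arrangement a b)).colon
    ((irrelevantIdeal ^ n : Ideal S) : Set S)) n) ?_
  rw [Submodule.mem_colon]
  intro p hp
  have := (mem_K p).mp (hn hp)
  rwa [smul_eq_mul, mul_comm]

/-- Membership would make -1 a value of `relForm`, but all its coefficients vanish at the origin;
for H this uses `a ≤ b`. -/
theorem satGen_notMem (ha : 1 ≤ a) (hab : a ≤ b) :
    satGen a b ∉ jacobianIdeal (arrangement a b) := by
  obtain ⟨Q, -, hQ⟩ := exists_pencil_sub_pencil (Finset.Icc 2 (b + 1)) ⟨2, by simp; omega⟩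
  intro h
  obtain ⟨θ, hθ⟩ := mem_jacobianIdeal_iff.mp h
  obtain ⟨w, -, hw⟩ := exists_eq_syzField ha hab hQ (θ := θ) (c := -1)
    (by rw [hθ, satGen]; ring)
  have := congr_arg (eval (0 : Fin 3 → ℂ)) hw
  rw [relForm_apply] at this
  have hH : eval (0 : Fin 3 → ℂ) (cofactor a b) = 0 := eval_cofactor_eq_zero hab (by simp)
  rw [map_add, map_sub, map_mul, map_mul, map_mul, eval_lin, eval_lin, hH] at this
  simp at this

/-! ### Graded pieces of N(f) -/

theorem isHomogeneous_deletion (a b : ℕ) : (deletion a b).IsHomogeneous (1 + a + b) := by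
  have hA : (pencilA a).IsHomogeneous a := by simpa using isHomogeneous_pencil 1 (Finset.Icc 1 a)
  have hB : (pencilB b).IsHomogeneous b := by
    simpa using isHomogeneous_pencil 2 (Finset.Icc 2 (b + 1))
  exact ((isHomogeneous_X ℂ 0).mul hA).mul hB

theorem isHomogeneous_arrangement (a b : ℕ) :
    (arrangement a b).IsHomogeneous (1 + (1 + a + b)) :=
  (isHomogeneous_lin 1 2 1).mul (isHomogeneous_deletion a b)

theorem isHomogeneous_satGen (a b : ℕ) : ∃ e, (satGen a b).IsHomogeneous e :=
  ⟨_, (isHomogeneous_deletion a b).mul (isHomogeneous_pencil 1 (Finset.Icc 2 a))⟩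

theorem homogeneousComponent_mem_jacobianIdeal {f h : S} {d : ℕ} (hf : f.IsHomogeneous d)
    (hh : h ∈ jacobianIdeal f) (k : ℕ) : homogeneousComponent k h ∈ jacobianIdeal f := by
  let := gradedAlgebra (σ := Fin 3) (R := ℂ)
  refine homogeneousComponent_mem_of_mem
    (Ideal.homogeneous_span (homogeneousSubmodule (Fin 3) ℂ) _ ?_) hh k
  rintro _ ⟨i, rfl⟩
  exact ⟨d - 1, hf.pderiv⟩

theorem homogeneousComponent_mul_of_isHomogeneous {p q : S} {e : ℕ} (hq : q.IsHomogeneous e)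
    (k : ℕ) : homogeneousComponent k (p * q) =
      if e ≤ k then homogeneousComponent (k - e) p * q else 0 := by
  have hterm (i : ℕ) : homogeneousComponent k (homogeneousComponent i p * q) =
      if i + e = k then homogeneousComponent i p * q else 0 := by
    have := homogeneousComponent_of_mem (m := k)
      ((homogeneousComponent_isHomogeneous i p).mul hq)
    rw [this]
    simp only [eq_comm]
  conv_lhs => rw [← sum_homogeneousComponent p, Finset.sum_mul, map_sum]
  simp only [hterm]
  split_ifs with hek
  · have (i : ℕ) : i + e = k ↔ k - e = i := by omega
    simp only [this, Finset.sum_ite_eq, Finset.mem_range]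
    split_ifs with hlt
    · rfl
    · rw [homogeneousComponent_eq_zero _ _ (by omega), zero_mul]
  · refine Finset.sum_eq_zero fun i _ => if_neg (by omega)

theorem diag_of_isHomogeneous {p : S} {n : ℕ} (hp : p.IsHomogeneous n) :
    ∃ c : ℂ, diag p = C c * X 0 ^ n := by
  refine ⟨∑ m ∈ p.support, coeff m p, ?_⟩
  rw [diag, aeval_def, eval₂_eq, map_sum, Finset.sum_mul]
  refine Finset.sum_congr rfl fun m hm => ?_
  rw [Finset.prod_pow_eq_pow_sum, ← hp.degree_eq_sum_deg_support hm]
  rfl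

/-- Modulo the Jacobian ideal, its saturation is spanned in each degree by one form. -/
theorem exists_spanning_form (ha : 1 ≤ a) (hab : a ≤ b) (k : ℕ) :
    ∃ v ∈ degreePart (saturatedJacobianIdeal (arrangement a b)) k,
      ∀ h ∈ degreePart (saturatedJacobianIdeal (arrangement a b)) k,
        ∃ c : ℂ, c • v - h ∈ jacobianIdeal (arrangement a b) := by
  obtain ⟨e, he⟩ := isHomogeneous_satGen a b
  have key : ∀ h ∈ degreePart (saturatedJacobianIdeal (arrangement a b)) k, ∃ r : S,
      h - homogeneousComponent k (r * satGen a b) ∈ jacobianIdeal (arrangement a b) := by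
    rintro h ⟨hI, hk⟩
    obtain ⟨j, hj, t, ht, rfl⟩ := Submodule.mem_sup.mp (saturatedJacobianIdeal_le ha hab hI)
    obtain ⟨r, rfl⟩ := Ideal.mem_span_singleton'.mp ht
    refine ⟨r, ?_⟩
    have h1 := homogeneousComponent_mem_jacobianIdeal (isHomogeneous_arrangement a b) hj k
    have h2 : homogeneousComponent k (j + r * satGen a b) = j + r * satGen a b :=
      homogeneousComponent_eq_self hk
    rw [map_add] at h2
    rwa [← h2, add_sub_cancel_right]
  by_cases hek : e ≤ k
  -- Multiplication of `satGen` by x - y or y - z lands in the Jacobian ideal, so a form multiplying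
  -- it may be replaced by its image under `diag`, a scalar times a power of x.
  · refine ⟨X 0 ^ (k - e) * satGen a b, ⟨Ideal.mul_mem_left _ _ (satGen_mem ha hab), ?_⟩, ?_⟩
    · have := (isHomogeneous_X_pow (R := ℂ) (0 : Fin 3) (k - e)).mul he
      rwa [Nat.sub_add_cancel hek] at this
    · intro h hh
      obtain ⟨r, hr⟩ := key h hh
      rw [homogeneousComponent_mul_of_isHomogeneous he, if_pos hek] at hr
      obtain ⟨c, hc⟩ := diag_of_isHomogeneous (homogeneousComponent_isHomogeneous (k - e) r)
      have h3 := lin_mul_satGen_mem ha hab (sub_diag_mem (homogeneousComponent (k - e) r))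
      refine ⟨c, ?_⟩
      rw [← neg_mem_iff]
      convert Ideal.add_mem _ hr h3 using 1
      rw [hc, smul_eq_C_mul]
      ring
  · refine ⟨0, zero_mem _, fun h hh => ⟨0, ?_⟩⟩
    obtain ⟨r, hr⟩ := key h hh
    rw [homogeneousComponent_mul_of_isHomogeneous he, if_neg hek, sub_zero] at hr
    rw [smul_zero, zero_sub]
    exact neg_mem hr

theorem isNearlyFree_arrangement (ha : 1 ≤ a) (hab : a ≤ b) : IsNearlyFree (arrangement a b) := by
  refine ⟨fun h => satGen_notMem ha hab (h ▸ satGen_mem ha hab), fun k => ?_⟩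
  obtain ⟨v, hv, H⟩ := exists_spanning_form ha hab k
  rw [rank_le_one_iff]
  refine ⟨Submodule.Quotient.mk ⟨v, hv⟩, fun q => ?_⟩
  obtain ⟨⟨h, hh⟩, rfl⟩ := Submodule.Quotient.mk_surjective _ q
  obtain ⟨c, hc⟩ := H h hh
  refine ⟨c, ?_⟩
  rw [← Submodule.Quotient.mk_smul, Submodule.Quotient.eq]
  exact ⟨hc, Submodule.sub_mem _ (Submodule.smul_mem _ c hv.2) hh.2⟩

end

/-! ### The lines of the arrangement -/

/-- The coefficient vector of `xᵢ - c xⱼ`. -/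
def linVec (i j : Fin 3) (c : ℂ) : Fin 3 → ℂ := Pi.single i 1 - c • Pi.single j 1

theorem linVec_dotProduct (i j : Fin 3) (c : ℂ) (w : Fin 3 → ℂ) :
    linVec i j c ⬝ᵥ w = w i - c * w j := by
  simp [linVec, sub_dotProduct, smul_dotProduct]

theorem linVec_ne_zero {i j : Fin 3} (hij : i ≠ j) (c : ℂ) : linVec i j c ≠ 0 := by
  intro h
  have := linVec_dotProduct i j c (Pi.single i 1)
  simp [h, hij.symm] at this

/-- The line `xᵢ = c xⱼ`. -/
def lineOf {i j : Fin 3} (hij : i ≠ j) (c : ℂ) : ℙ ℂ (Fin 3 → ℂ) :=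
  Projectivization.mk ℂ (linVec i j c) (linVec_ne_zero hij c)

theorem orthogonal_lineOf {i j : Fin 3} (hij : i ≠ j) (c : ℂ) {w : Fin 3 → ℂ} (hw : w ≠ 0) :
    Projectivization.orthogonal (lineOf hij c) (Projectivization.mk ℂ w hw) ↔
      w i - c * w j = 0 := by
  rw [lineOf, Projectivization.orthogonal_mk, linVec_dotProduct]

theorem eval_linearForm (L : ℙ ℂ (Fin 3 → ℂ)) (P : Fin 3 → ℂ) :
    eval P (linearForm L) = L.rep ⬝ᵥ P := by
  simp [linearForm, dotProduct]

theorem linearForm_lineOf {i j : Fin 3} (hij : i ≠ j) (c : ℂ) :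
    ∃ u : ℂ, u ≠ 0 ∧ linearForm (lineOf hij c) = C u * lin i j c := by
  obtain ⟨u, hu⟩ := Projectivization.exists_smul_eq_mk_rep ℂ (linVec i j c) (linVec_ne_zero hij c)
  refine ⟨u, u.ne_zero, MvPolynomial.funext fun P => ?_⟩
  rw [eval_linearForm, lineOf, ← hu, Units.smul_def, smul_dotProduct, linVec_dotProduct, map_mul,
    eval_lin, eval_C, smul_eq_mul]

theorem eq_lineOf_of_lin_dvd {i j : Fin 3} (hij : i ≠ j) {c : ℂ} {L : ℙ ℂ (Fin 3 → ℂ)}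
    (h : lin i j c ∣ linearForm L) : L = lineOf hij c := by
  have hP (P : Fin 3 → ℂ) (hP : P i = c * P j) : L.rep ⬝ᵥ P = 0 := by
    obtain ⟨q, hq⟩ := h
    rw [← eval_linearForm, hq, map_mul, eval_lin, hP, sub_self, zero_mul]
  have hj : L.rep j = - c * L.rep i := by
    have := hP (c • Pi.single i 1 + Pi.single j 1) (by simp [hij, hij.symm])
    rw [dotProduct_add, dotProduct_smul, dotProduct_single_one, dotProduct_single_one,
      smul_eq_mul] at this
    linear_combination this
  have hm (m : Fin 3) (hi : m ≠ i) (hj : m ≠ j) : L.rep m = 0 := by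
    have := hP (Pi.single m 1) (by simp [hi.symm, hj.symm])
    rwa [dotProduct_single_one] at this
  rw [← L.mk_rep, lineOf, Projectivization.mk_eq_mk_iff']
  refine ⟨L.rep i, ?_⟩
  ext1 m
  by_cases h1 : m = i
  · subst h1
    simp [linVec, hij]
  by_cases h2 : m = j
  · subst h2
    simp [linVec, hij.symm, hj, mul_comm]
  · simp [linVec, h1, h2, hm m h1 h2]

theorem arrangement_eq (a b : ℕ) : arrangement a b =
    lin 1 2 1 * (pencil 1 (Finset.Icc 0 a) * pencil 2 (Finset.Icc 2 (b + 1))) := by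
  have h : Finset.Icc 0 a = insert 0 (Finset.Icc 1 a) := by
    ext k
    simp only [Finset.mem_Icc, Finset.mem_insert]
    omega
  have hX : pencil 1 (Finset.Icc 0 a) = X 0 * pencilA a := by
    rw [h, pencil, Finset.prod_insert (by simp)]
    simp [lin, pencil]
  rw [hX, arrangement, deletion]

theorem not_isUnit_linearForm (L : ℙ ℂ (Fin 3 → ℂ)) : ¬ IsUnit (linearForm L) := by
  intro h
  have := h.map (eval (0 : Fin 3 → ℂ))
  rw [eval_linearForm, dotProduct_zero] at this
  exact not_isUnit_zero this

theorem isRelPrime_lin {i j : Fin 3} (hij : i ≠ j) {c : ℂ} {p : S} (h : ¬ lin i j c ∣ p) :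
    IsRelPrime p (lin i j c) :=
  ((prime_lin hij c).irreducible.isRelPrime_iff_not_dvd.mpr h).symm

/-- The lines `x = k xₜ` for `k ∈ s`. -/
def pencilLines {t : Fin 3} (ht : 0 ≠ t) (s : Finset ℕ) : Set (ℙ ℂ (Fin 3 → ℂ)) :=
  (fun k : ℕ => lineOf ht (k : ℂ)) '' s

theorem isRelPrime_pencil {t : Fin 3} (ht : 0 ≠ t) {s : Finset ℕ} {L : ℙ ℂ (Fin 3 → ℂ)}
    (h : L ∉ pencilLines ht s) : IsRelPrime (linearForm L) (pencil t s) :=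
  IsRelPrime.prod_right fun k hk =>
    isRelPrime_lin ht fun hd => h ⟨k, hk, (eq_lineOf_of_lin_dvd ht hd).symm⟩

theorem linearForm_lineOf_dvd {i j : Fin 3} (hij : i ≠ j) (c : ℂ) :
    linearForm (lineOf hij c) ∣ lin i j c := by
  obtain ⟨u, hu, h⟩ := linearForm_lineOf hij c
  refine ⟨C u⁻¹, ?_⟩
  rw [h, mul_right_comm, ← C_mul, mul_inv_cancel₀ hu, C_1, one_mul]

theorem linearForm_dvd_pencil {t : Fin 3} (ht : 0 ≠ t) {s : Finset ℕ} {L : ℙ ℂ (Fin 3 → ℂ)}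
    (h : L ∈ pencilLines ht s) : linearForm L ∣ pencil t s := by
  obtain ⟨k, hk, rfl⟩ := h
  exact (linearForm_lineOf_dvd ht _).trans (Finset.dvd_prod_of_mem _ hk)

theorem fin_one_ne_two : (1 : Fin 3) ≠ 2 := by decide
theorem fin_zero_ne_one : (0 : Fin 3) ≠ 1 := by decide
theorem fin_zero_ne_two : (0 : Fin 3) ≠ 2 := by decide

/-- A line outside the list has an equation coprime to every factor, so dividing the product would
make it a unit. -/
theorem lines_arrangement (a b : ℕ) : lines (arrangement a b) =
    {lineOf fin_one_ne_two 1} ∪ (pencilLines fin_zero_ne_one (Finset.Icc 0 a) ∪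
      pencilLines fin_zero_ne_two (Finset.Icc 2 (b + 1))) := by
  rw [arrangement_eq]
  ext L
  constructor
  · intro hL
    by_contra hn
    simp only [Set.mem_union, Set.mem_singleton_iff, not_or] at hn
    obtain ⟨h1, h2, h3⟩ := hn
    exact not_isUnit_linearForm L <| IsRelPrime.isUnit_of_dvd
      ((isRelPrime_lin fin_one_ne_two fun hd => h1 (eq_lineOf_of_lin_dvd _ hd)).mul_right
        ((isRelPrime_pencil _ h2).mul_right (isRelPrime_pencil _ h3))) hL
  · rintro (rfl | h | h)
    · exact (linearForm_lineOf_dvd _ _).mul_right _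
    · exact ((linearForm_dvd_pencil _ h).mul_right _).mul_left _
    · exact ((linearForm_dvd_pencil _ h).mul_left _).mul_left _

theorem encard_pencilLines {t : Fin 3} (ht : 0 ≠ t) (s : Finset ℕ) :
    (pencilLines ht s).encard = s.card := by
  rw [pencilLines, Set.InjOn.encard_image, Set.encard_coe_eq_coe_finsetCard]
  intro k _ l _ h
  have hw : (Pi.single 0 (k : ℂ) + Pi.single t 1 : Fin 3 → ℂ) ≠ 0 := by
    intro h0
    simpa [ht.symm] using congr_fun h0 t
  have h1 := (orthogonal_lineOf ht (k : ℂ) hw).mpr (by simp [ht, ht.symm])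
  simp only at h
  rw [h, orthogonal_lineOf] at h1
  simpa [ht, ht.symm, sub_eq_zero] using h1

theorem isLineArrangement_arrangement (a b : ℕ) :
    IsLineArrangement (arrangement a b) (a + 1 + (b + 1)) := by
  refine ⟨?_, ?_⟩
  · convert isHomogeneous_arrangement a b using 1
    omega
  have d1 : Disjoint (pencilLines fin_zero_ne_one (Finset.Icc 0 a))
      (pencilLines fin_zero_ne_two (Finset.Icc 2 (b + 1))) := by
    rw [Set.disjoint_left]
    rintro _ ⟨k, hk, rfl⟩ ⟨l, hl, h⟩
    -- The centre (0 : 0 : 1) of the first pencil lies on x = l z only for l = 0, and the second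
    -- index range starts at 2.
    have hw : (Pi.single 2 1 : Fin 3 → ℂ) ≠ 0 := by simp
    have h1 := (orthogonal_lineOf fin_zero_ne_one (k : ℂ) hw).mpr (by simp)
    simp only at h
    rw [← h, orthogonal_lineOf] at h1
    simp at h1
    simp [h1] at hl
  have d2 : Disjoint {lineOf fin_one_ne_two 1} (pencilLines fin_zero_ne_one (Finset.Icc 0 a) ∪
      pencilLines fin_zero_ne_two (Finset.Icc 2 (b + 1))) := by
    have hw : (Pi.single 0 1 : Fin 3 → ℂ) ≠ 0 := by simp
    have h1 := (orthogonal_lineOf fin_one_ne_two 1 hw).mpr (by simp)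
    rw [Set.disjoint_singleton_left]
    rintro (⟨k, hk, h⟩ | ⟨k, hk, h⟩) <;>
    · simp only at h
      rw [← h, orthogonal_lineOf] at h1
      simp at h1
  rw [lines_arrangement, Set.encard_union_eq d2, Set.encard_union_eq d1, Set.encard_singleton,
    encard_pencilLines, encard_pencilLines, Nat.card_Icc, Nat.card_Icc]
  norm_cast
  omega

/-! ### Points of multiplicity greater than three -/

theorem encard_pencilLines_orthogonal_le_one {t : Fin 3} (ht : 0 ≠ t) (s : Finset ℕ)
    {w : Fin 3 → ℂ} (hw : w ≠ 0) (h : ¬ (w 0 = 0 ∧ w t = 0)) :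
    {L ∈ pencilLines ht s |
      Projectivization.orthogonal L (Projectivization.mk ℂ w hw)}.encard ≤ 1 := by
  rw [Set.encard_le_one_iff]
  rintro _ _ ⟨⟨k, -, rfl⟩, hk⟩ ⟨⟨l, -, rfl⟩, hl⟩
  simp only [orthogonal_lineOf] at hk hl
  have hkl : ((k : ℂ) - l) * w t = 0 := by linear_combination hl - hk
  rcases mul_eq_zero.mp hkl with h1 | h1
  · simp only [sub_eq_zero.mp h1]
  · exact absurd ⟨by simpa [h1] using hk, h1⟩ h

/-- The two exceptions are the pencil centres (0 : 0 : 1) and (0 : 1 : 0). The line x = 0 is counted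
in the first pencil, so elsewhere the bound is 1 + 1 + 1. -/
theorem encard_multiplicity_arrangement_le (a b : ℕ) :
    {P : ℙ ℂ (Fin 3 → ℂ) | 3 < multiplicity (arrangement a b) P}.encard ≤ 2 := by
  have hs (i : Fin 3) : (Pi.single i 1 : Fin 3 → ℂ) ≠ 0 := by simp
  refine (Set.encard_le_encard (t := {Projectivization.mk ℂ _ (hs 2),
    Projectivization.mk ℂ _ (hs 1)}) ?_)
    |>.trans ((Set.encard_insert_le _ _).trans_eq
    (by rw [Set.encard_singleton, one_add_one_eq_two]))
  intro P hP
  induction P with | h w hw => ?_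
  by_contra hn
  rw [Set.mem_insert_iff, Set.mem_singleton_iff, not_or] at hn
  have h1 : ¬ (w 0 = 0 ∧ w 1 = 0) := by
    rintro ⟨h0, h1⟩
    refine hn.1 ((Projectivization.mk_eq_mk_iff' ..).mpr ⟨w 2, ?_⟩)
    ext1 i
    fin_cases i <;> simp [h0, h1]
  have h2 : ¬ (w 0 = 0 ∧ w 2 = 0) := by
    rintro ⟨h0, h2⟩
    refine hn.2 ((Projectivization.mk_eq_mk_iff' ..).mpr ⟨w 1, ?_⟩)
    ext1 i
    fin_cases i <;> simp [h0, h2]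
  refine (not_lt.mpr ?_ : ¬ 3 < multiplicity _ _) hP
  rw [multiplicity, lines_arrangement]
  refine (Set.encard_le_encard (t := {lineOf fin_one_ne_two 1} ∪
    ({L ∈ pencilLines fin_zero_ne_one (Finset.Icc 0 a) |
      Projectivization.orthogonal L (Projectivization.mk ℂ w hw)} ∪
    {L ∈ pencilLines fin_zero_ne_two (Finset.Icc 2 (b + 1)) |
      Projectivization.orthogonal L (Projectivization.mk ℂ w hw)})) ?_).trans ?_
  · rintro L ⟨h | h | h, ho⟩
    · exact Or.inl h
    · exact Or.inr (Or.inl ⟨h, ho⟩)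
    · exact Or.inr (Or.inr ⟨h, ho⟩)
  · refine (Set.encard_union_le _ _).trans ?_
    rw [Set.encard_singleton]
    have := (Set.encard_union_le _ _).trans (add_le_add
      (encard_pencilLines_orthogonal_le_one fin_zero_ne_one (Finset.Icc 0 a) hw h1)
      (encard_pencilLines_orthogonal_le_one fin_zero_ne_two (Finset.Icc 2 (b + 1)) hw h2))
    exact (add_le_add_right this 1).trans (by norm_num)

end PlaneCurve

end

theorem theorem3p4 (d₁ d₂ : ℕ) (h₁ : 2 ≤ d₁) (h₂ : d₁ ≤ d₂) (f : PlaneCurve.S)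
    (hf : f = X 0 * (X 1 - X 2) * PlaneCurve.g 1 (d₁ - 1) (X 0) (X 1) *
      PlaneCurve.g 2 d₂ (X 0) (X 2)) :
    PlaneCurve.IsLineArrangement f (d₁ + d₂) ∧
    PlaneCurve.IsNearlyFreeWithExponents f d₁ d₂ ∧
    {P : ℙ ℂ (Fin 3 → ℂ) | 3 < PlaneCurve.multiplicity f P}.encard ≤ 2 := by
  obtain ⟨a, rfl⟩ : ∃ a, d₁ = a + 1 := ⟨d₁ - 1, by omega⟩
  obtain ⟨b, rfl⟩ : ∃ b, d₂ = b + 1 := ⟨d₂ - 1, by omega⟩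
  have ha : 1 ≤ a := by omega
  have hab : a ≤ b := by omega
  have hfa : f = PlaneCurve.arrangement a b := by
    rw [hf, PlaneCurve.g_eq_pencil, PlaneCurve.g_eq_pencil, PlaneCurve.arrangement,
      PlaneCurve.deletion, Nat.add_sub_cancel, PlaneCurve.lin, C_1]
    ring
  rw [hfa]
  exact ⟨PlaneCurve.isLineArrangement_arrangement a b,
    ⟨PlaneCurve.isNearlyFree_arrangement ha hab, h₂,
      PlaneCurve.hasMinimalSyzygyDegrees_arrangement ha hab⟩,
    PlaneCurve.encard_multiplicity_arrangement_le a b⟩
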